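/- Let $d\ge 1$ be an integer, $\mathbb{D}=\{z\in\mathbb{C}:|z|<1\}$, and let $\overline{\mathbb{D}}$ be its closure. Let $A_{\mathrm{sym}}(\mathbb{D}^d)$ be the commutative ring, under pointwise operations, of all continuous functions $f:\overline{\mathbb{D}}^d\to\mathbb{C}$ that are holomorphic in $\mathbb{D}^d$ and symmetric, i.e. $f(z_{\sigma(1)},\dots,z_{\sigma(d)})=f(z_1,\dots,z_d)$ for all $(z_1,\dots,z_d)\in\mathbb{D}^d$ and all permutations $\sigma$ of $\{1,\dots,d\}$. A unital commutative ring $R$ is called coherent if the intersection of any two finitely generated ideals of $R$ is finitely generated and, for every $a\in R$, the annihilator $\{x\in R: ax=0\}$ is finitely generated. Then $A_{\mathrm{sym}}(\mathbb{D}^d)$ is not coherent. -/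

import Mathlib

/-- A commutative ring is coherent if the intersection of any two finitely generated ideals is
finitely generated, and the annihilator `{x | x * a = 0}` of every element `a` is finitely
generated. -/
structure IsCoherentRing (R : Type*) [CommRing R] : Prop where
  inf_fg : ∀ I J : Ideal R, I.FG → J.FG → (I ⊓ J).FG
  ann_fg : ∀ a : R, (Ideal.torsionOf R R a).FG

/-- The open unit polydisc in `ℂ^d`. -/
def polydisc (d : ℕ) : Set (Fin d → ℂ) := {z | ∀ i, ‖z i‖ < 1}

/-- The closed unit polydisc in `ℂ^d`. -/
def closedPolydisc (d : ℕ) : Set (Fin d → ℂ) := {z | ∀ i, ‖z i‖ ≤ 1}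

/-- The action of a permutation on the closed polydisc:
`σ z = (z_{σ(1)}, …, z_{σ(d)})`. -/
def permPoint {d : ℕ} (σ : Equiv.Perm (Fin d)) (z : closedPolydisc d) : closedPolydisc d :=
  ⟨fun i => z.1 (σ i), fun i => z.2 (σ i)⟩

/-- A function on the closed polydisc is holomorphic in the open polydisc: it agrees there with
a function on `ℂ^d` that is complex differentiable at each point of the (open) polydisc. The
values of the latter function off the polydisc play no role. -/
def HolomorphicInside {d : ℕ} (f : closedPolydisc d → ℂ) : Prop :=
  ∃ F : (Fin d → ℂ) → ℂ, DifferentiableOn ℂ F (polydisc d) ∧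
    ∀ z : closedPolydisc d, (z : Fin d → ℂ) ∈ polydisc d → F z = f z

/-- The polydisc algebra: continuous functions on the closed polydisc that are holomorphic in
the open polydisc, with pointwise operations. -/
def polydiscAlgebra (d : ℕ) : Subalgebra ℂ C(closedPolydisc d, ℂ) where
  carrier := {f | HolomorphicInside f}
  mul_mem' := by
    rintro f g ⟨F, hF, hFf⟩ ⟨G, hG, hGg⟩
    exact ⟨fun z => F z * G z, hF.mul hG, fun z hz => by simp [hFf z hz, hGg z hz]⟩
  add_mem' := by
    rintro f g ⟨F, hF, hFf⟩ ⟨G, hG, hGg⟩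
    exact ⟨fun z => F z + G z, hF.add hG, fun z hz => by simp [hFf z hz, hGg z hz]⟩
  algebraMap_mem' := by
    intro c
    exact ⟨fun _ => c, differentiableOn_const c, fun z _ => by simp⟩

/-- A function is symmetric if `f (σ z) = f z` for all `z` in the open polydisc and all
permutations `σ`. -/
def IsSymmetricFun {d : ℕ} (f : closedPolydisc d → ℂ) : Prop :=
  ∀ z : closedPolydisc d, (z : Fin d → ℂ) ∈ polydisc d →
    ∀ σ : Equiv.Perm (Fin d), f (permPoint σ z) = f z

/-- The algebra of symmetric functions in the polydisc algebra. -/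
def symPolydiscAlgebra (d : ℕ) : Subalgebra ℂ C(closedPolydisc d, ℂ) where
  carrier := {f | f ∈ polydiscAlgebra d ∧ IsSymmetricFun f}
  mul_mem' := by
    rintro f g ⟨hf, hf'⟩ ⟨hg, hg'⟩
    exact ⟨mul_mem hf hg, fun z hz σ => by simp [hf' z hz σ, hg' z hz σ]⟩
  add_mem' := by
    rintro f g ⟨hf, hf'⟩ ⟨hg, hg'⟩
    exact ⟨add_mem hf hg, fun z hz σ => by simp [hf' z hz σ, hg' z hz σ]⟩
  algebraMap_mem' := by
    intro c
    exact ⟨Subalgebra.algebraMap_mem _ c, fun z _ σ => by simp⟩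

/-!
The disc algebra is a retract of the algebra of symmetric functions on the polydisc: restrict to
the diagonal, and compose with the mean of the coordinates. Coherence passes to retracts, so it
suffices to treat the disc algebra.

There let `S w = exp (-1 / (1 - w))`, `f w = 1 - w` and `g = S * f`. If `f * u = g * v`, then
`u = S * v` is continuous at `1`, where `S` tends to `0` along the radius but has modulus `e⁻¹`
along the horocycle `Re (1 / (1 - w)) = 1`; this forces `v 1 = 0`. Conversely `S * v` is in the
disc algebra whenever `v 1 = 0`. Hence `(f) ∩ (g) = g * M`, where `M` is the maximal ideal of
functions vanishing at `1`, and a finite generating set of this intersection would give one of `M`.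
But every element of a finitely generated ideal is `O` of the sum `ω` of the moduli of the
generators, while `M` contains functions that decay at `1` more slowly than any prescribed `ω` that
tends to `0` there.
-/

open Filter Topology Metric Asymptotics
open scoped BigOperators

theorem IsCoherentRing.of_leftInverse {R A : Type*} [CommRing R] [CommRing A]
    (hR : IsCoherentRing R) {ρ : R →+* A} {ι : A →+* R} (h : Function.LeftInverse ρ ι) :
    IsCoherentRing A where
  inf_fg I J hI hJ := by
    have hρ (K : Ideal A) : (K.map ι).map ρ = K := by
      rw [Ideal.map_map, RingHom.ext (f := ρ.comp ι) (g := RingHom.id A) h, Ideal.map_id]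
    suffices I ⊓ J = (I.map ι ⊓ J.map ι).map ρ from
      this ▸ (hR.inf_fg _ _ (hI.map ι) (hJ.map ι)).map ρ
    refine le_antisymm (fun x hx ↦ ?_) (le_inf ?_ ?_)
    · exact h x ▸ Ideal.mem_map_of_mem ρ
        ⟨Ideal.mem_map_of_mem ι hx.1, Ideal.mem_map_of_mem ι hx.2⟩
    · exact (Ideal.map_mono inf_le_left).trans (hρ I).le
    · exact (Ideal.map_mono inf_le_right).trans (hρ J).le
  ann_fg a := by
    suffices Ideal.torsionOf A A a = (Ideal.torsionOf R R (ι a)).map ρ from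
      this ▸ (hR.ann_fg (ι a)).map ρ
    refine le_antisymm (fun x hx ↦ ?_) (Ideal.map_le_iff_le_comap.2 fun x hx ↦ ?_)
    · refine h x ▸ Ideal.mem_map_of_mem ρ ?_
      have hx : x * a = 0 := hx
      simpa only [Ideal.mem_torsionOf_iff, smul_eq_mul, map_mul, map_zero] using congrArg ι hx
    · have hx : x * ι a = 0 := hx
      simpa only [Ideal.mem_comap, Ideal.mem_torsionOf_iff, smul_eq_mul, map_mul, map_zero, h a]
        using congrArg ρ hx

lemma isBigO_sum_norm_of_mem_span {X : Type*} [TopologicalSpace X] {S : Subalgebra ℂ C(X, ℂ)}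
    {T : Finset S} {v : S} (hv : v ∈ Ideal.span (T : Set S)) (x : X) :
    v.1 =O[𝓝 x] fun y ↦ ∑ t ∈ T, ‖t.1 y‖ := by
  induction hv using Submodule.span_induction with
  | mem t ht =>
    refine .of_norm_le fun y ↦ ?_
    exact Finset.single_le_sum (f := fun t : S ↦ ‖t.1 y‖) (fun _ _ ↦ norm_nonneg _) ht
  | zero => exact isBigO_zero _ _
  | add u v _ _ hu hv => exact hu.add hv
  | smul a v _ hv =>
    have ha : a.1 =O[𝓝 x] fun _ ↦ (1 : ℝ) := (a.1.continuous.tendsto x).isBigO_one ℝ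
    exact (ha.mul hv).congr_right fun _ ↦ one_mul _

/-- The disc algebra of continuous functions on the closed unit disc that are holomorphic inside,
with holomorphy encoded through an extension by arbitrary values, as in `HolomorphicInside`. -/
noncomputable def discAlgebra : Subalgebra ℂ C(closedBall (0 : ℂ) 1, ℂ) where
  carrier := {f | ∃ F : ℂ → ℂ, DifferentiableOn ℂ F (ball 0 1) ∧
    ∀ w : closedBall (0 : ℂ) 1, (w : ℂ) ∈ ball 0 1 → F w = f w}
  mul_mem' := by
    rintro f g ⟨F, hF, hFf⟩ ⟨G, hG, hGg⟩
    exact ⟨F * G, hF.mul hG, fun w hw ↦ by simp [hFf w hw, hGg w hw]⟩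
  add_mem' := by
    rintro f g ⟨F, hF, hFf⟩ ⟨G, hG, hGg⟩
    exact ⟨F + G, hF.add hG, fun w hw ↦ by simp [hFf w hw, hGg w hw]⟩
  algebraMap_mem' c := ⟨fun _ ↦ c, differentiableOn_const c, fun w _ ↦ by simp⟩

namespace discAlgebra

/-- The element of the disc algebra given by a function on `ℂ` that is already continuous on the
closed disc and holomorphic inside. -/
noncomputable def restrict (Φ : ℂ → ℂ) (hc : ContinuousOn Φ (closedBall 0 1))
    (hd : DifferentiableOn ℂ Φ (ball 0 1)) : discAlgebra :=
  ⟨⟨(closedBall 0 1).domRestrict Φ, hc.domRestrict⟩, Φ, hd, fun _ _ ↦ rfl⟩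

/-- The maximal ideal of the disc algebra consisting of the functions that vanish at the boundary
point `1`; it is the kernel of evaluation there, and it is not finitely generated. -/
noncomputable def idealAtOne : Ideal discAlgebra :=
  RingHom.ker (((Pi.evalRingHom _ 1).comp ContinuousMap.coeFnRingHom).comp
    discAlgebra.subtype : discAlgebra →+* ℂ)

lemma mem_idealAtOne {f : discAlgebra} : f ∈ idealAtOne ↔ f.1 1 = 0 := Iff.rfl

lemma re_le_one (w : closedBall (0 : ℂ) 1) : (w : ℂ).re ≤ 1 :=
  (Complex.re_le_norm _).trans (mem_closedBall_zero_iff.1 w.2)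

lemma ne_one_of_mem_ball {w : ℂ} (hw : w ∈ ball 0 1) : w ≠ 1 := by
  rintro rfl
  simp at hw

/-- The inverse of the Cayley-type map `w ↦ 1 / (1 - w)`: it takes `ζ = ∞` to `1`, real `ζ` to the
radius ending at `1` and vertical lines to horocycles at `1`. The map sends the half-plane
`1 / 2 ≤ ζ.re` into the closed disc; `1 ≤ ζ.re` is enough to approach `1` along both kinds of
curve. -/
noncomputable def cayley (ζ : ℂ) (hζ : 1 ≤ ζ.re) : closedBall (0 : ℂ) 1 :=
  ⟨1 - ζ⁻¹, by
    have hζ0 : ζ ≠ 0 := by rintro rfl; norm_num at hζ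
    rw [mem_closedBall_zero_iff, ← one_div, one_sub_div hζ0, norm_div]
    refine div_le_one_of_le₀ ?_ (norm_nonneg _)
    rw [Complex.norm_def, Complex.norm_def]
    refine Real.sqrt_le_sqrt ?_
    simp only [Complex.normSq_apply, Complex.sub_re, Complex.sub_im, Complex.one_re,
      Complex.one_im]
    linarith⟩

lemma cayley_ne_one {ζ : ℂ} (hζ : 1 ≤ ζ.re) : cayley ζ hζ ≠ 1 := by
  intro h
  have h : 1 - ζ⁻¹ = 1 := congrArg Subtype.val h
  have hζ0 : ζ = 0 := by simpa using h
  rw [hζ0] at hζ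
  norm_num at hζ

lemma tendsto_cayley {α : Type*} {l : Filter α} {ζ : α → ℂ} (hζ : ∀ a, 1 ≤ (ζ a).re)
    (h : Tendsto ζ l (Bornology.cobounded ℂ)) : Tendsto (fun a ↦ cayley (ζ a) (hζ a)) l (𝓝 1) := by
  rw [tendsto_subtype_rng]
  simpa [cayley] using (tendsto_inv₀_cobounded.comp h).const_sub 1

/-- A singular inner function with point mass at `1`, up to a constant factor. Its modulus is
constant on the horocycles at `1` but tends to `0` along the radius ending there. At `w = 1` it has
the junk value `1`. -/
noncomputable def singularInner (w : ℂ) : ℂ := Complex.exp (-(1 - w)⁻¹)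

lemma differentiableAt_singularInner {w : ℂ} (hw : w ≠ 1) :
    DifferentiableAt ℂ singularInner w := by
  have : 1 - w ≠ 0 := sub_ne_zero.2 hw.symm
  unfold singularInner
  fun_prop (disch := assumption)

lemma norm_singularInner_le_one {w : ℂ} (hw : w.re ≤ 1) : ‖singularInner w‖ ≤ 1 := by
  rw [singularInner, Complex.norm_exp, Real.exp_le_one_iff, Complex.neg_re, neg_nonpos,
    Complex.inv_re]
  exact div_nonneg (by simpa using hw) (Complex.normSq_nonneg _)

lemma norm_singularInner_cayley {ζ : ℂ} (hζ : 1 ≤ ζ.re) :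
    ‖singularInner (cayley ζ hζ)‖ = Real.exp (-ζ.re) := by
  simp [singularInner, cayley, Complex.norm_exp]

lemma continuous_singularInner_mul {v : C(closedBall (0 : ℂ) 1, ℂ)} (hv : v 1 = 0) :
    Continuous fun w : closedBall (0 : ℂ) 1 ↦ singularInner w * v w := by
  rw [continuous_iff_continuousAt]
  intro w
  rcases eq_or_ne w 1 with rfl | hw
  · have hlim := (v.continuous.tendsto 1).norm
    rw [hv, norm_zero] at hlim
    rw [ContinuousAt, hv, mul_zero]
    refine squeeze_zero_norm (fun z ↦ ?_) hlim
    rw [norm_mul]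
    exact mul_le_of_le_one_left (norm_nonneg _) (norm_singularInner_le_one (re_le_one z))
  · have hw : (w : ℂ) ≠ 1 := fun h ↦ hw (Subtype.ext h)
    exact ((differentiableAt_singularInner hw).continuousAt.comp
      continuous_subtype_val.continuousAt).mul v.continuous.continuousAt

lemma exists_eq_singularInner_mul {v : discAlgebra} (hv : v ∈ idealAtOne) :
    ∃ u : discAlgebra, ∀ w, u.1 w = singularInner w * v.1 w := by
  obtain ⟨V, hV, hVv⟩ := v.2
  have hd : DifferentiableOn ℂ (fun w ↦ singularInner w * V w) (ball 0 1) :=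
    DifferentiableOn.mul (fun w hw ↦ (differentiableAt_singularInner
      (ne_one_of_mem_ball hw)).differentiableWithinAt) hV
  exact ⟨⟨⟨_, continuous_singularInner_mul hv⟩, _, hd, fun w hw ↦ by simp [hVv w hw]⟩,
    fun w ↦ rfl⟩

lemma norm_apply_one_eq_mul {α : Type*} {l : Filter α} [l.NeBot] {u v : C(closedBall (0 : ℂ) 1, ℂ)}
    (huv : ∀ w, w ≠ 1 → u w = singularInner w * v w) {ζ : α → ℂ} (hζ : ∀ a, 1 ≤ (ζ a).re)
    (h : Tendsto ζ l (Bornology.cobounded ℂ)) {c : ℝ}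
    (hc : Tendsto (fun a ↦ Real.exp (-(ζ a).re)) l (𝓝 c)) :
    ‖u 1‖ = c * ‖v 1‖ := by
  have hlim (f : C(closedBall (0 : ℂ) 1, ℂ)) :
      Tendsto (fun a ↦ ‖f (cayley (ζ a) (hζ a))‖) l (𝓝 ‖f 1‖) :=
    ((f.continuous.tendsto 1).comp (tendsto_cayley hζ h)).norm
  refine tendsto_nhds_unique (hlim u) ((hc.mul (hlim v)).congr fun a ↦ ?_)
  rw [huv _ (cayley_ne_one _), norm_mul, norm_singularInner_cayley]

lemma tendsto_cobounded_one_add_natCast :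
    Tendsto (fun n : ℕ ↦ (1 + n : ℂ)) atTop (Bornology.cobounded ℂ) := by
  rw [← tendsto_norm_atTop_iff_cobounded]
  refine tendsto_atTop_mono (fun n ↦ ?_) tendsto_natCast_atTop_atTop
  exact (by simp : (n : ℝ) ≤ (1 + n : ℂ).re).trans (Complex.re_le_norm _)

lemma tendsto_cobounded_one_add_natCast_mul_I :
    Tendsto (fun n : ℕ ↦ (1 + n * Complex.I : ℂ)) atTop (Bornology.cobounded ℂ) := by
  rw [← tendsto_norm_atTop_iff_cobounded]
  refine tendsto_atTop_mono (fun n ↦ ?_) tendsto_natCast_atTop_atTop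
  exact (by simp : (n : ℝ) ≤ (1 + n * Complex.I : ℂ).im).trans (Complex.im_le_norm _)

lemma apply_one_eq_zero_of_eq_singularInner_mul {u v : C(closedBall (0 : ℂ) 1, ℂ)}
    (huv : ∀ w, w ≠ 1 → u w = singularInner w * v w) : v 1 = 0 := by
  have hradial : ‖u 1‖ = 0 * ‖v 1‖ := by
    refine norm_apply_one_eq_mul huv (by simp) tendsto_cobounded_one_add_natCast ?_
    simpa [Function.comp_def] using Real.tendsto_exp_neg_atTop_nhds_zero.comp
      (tendsto_atTop_add_const_left _ 1 tendsto_natCast_atTop_atTop)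
  have hhoro : ‖u 1‖ = Real.exp (-1) * ‖v 1‖ :=
    norm_apply_one_eq_mul huv (by simp) tendsto_cobounded_one_add_natCast_mul_I (by simp)
  simpa using hradial.symm.trans hhoro

/-- A function vanishing at `1` but equal to `1 / 2` already at the nearby point `1 - δ`, with
values in the right half of the closed unit disc. -/
noncomputable def dip (δ : ℝ) (w : ℂ) : ℂ := (1 - w) / (δ + (1 - w))

lemma le_re_add_one_sub {δ : ℝ} {w : ℂ} (hw : w.re ≤ 1) : δ ≤ (δ + (1 - w) : ℂ).re := by
  simpa using hw

lemma add_one_sub_ne_zero {δ : ℝ} (hδ : 0 < δ) {w : ℂ} (hw : w.re ≤ 1) :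
    (δ + (1 - w) : ℂ) ≠ 0 := by
  intro h
  have := le_re_add_one_sub (δ := δ) hw
  rw [h, Complex.zero_re] at this
  exact hδ.not_ge this

lemma differentiableAt_dip {δ : ℝ} (hδ : 0 < δ) {w : ℂ} (hw : w.re ≤ 1) :
    DifferentiableAt ℂ (dip δ) w := by
  have := add_one_sub_ne_zero hδ hw
  unfold dip
  fun_prop (disch := assumption)

lemma re_dip_nonneg {δ : ℝ} (hδ : 0 ≤ δ) {w : ℂ} (hw : w.re ≤ 1) : 0 ≤ (dip δ w).re := by
  have hre : 0 ≤ (1 - w).re := by simpa using hw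
  have him : (δ + (1 - w)).im = (1 - w).im := by simp
  rw [dip, Complex.div_re, him]
  exact add_nonneg
    (div_nonneg (mul_nonneg hre (hδ.trans (le_re_add_one_sub hw))) (Complex.normSq_nonneg _))
    (div_nonneg (mul_self_nonneg _) (Complex.normSq_nonneg _))

lemma norm_dip_le_one {δ : ℝ} (hδ : 0 ≤ δ) {w : ℂ} (hw : w.re ≤ 1) : ‖dip δ w‖ ≤ 1 := by
  rw [dip, norm_div]
  refine div_le_one_of_le₀ ?_ (norm_nonneg _)
  rw [Complex.norm_def, Complex.norm_def]
  refine Real.sqrt_le_sqrt ?_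
  simp only [Complex.normSq_apply, Complex.add_re, Complex.sub_re, Complex.one_re,
    Complex.ofReal_re, Complex.add_im, Complex.sub_im, Complex.one_im, Complex.ofReal_im]
  nlinarith

lemma dip_one_sub_self {δ : ℝ} (hδ : δ ≠ 0) : dip δ (1 - δ) = 1 / 2 := by
  have : (δ : ℂ) ≠ 0 := by exact_mod_cast hδ
  rw [dip, sub_sub_cancel, ← two_mul, div_mul_cancel_right₀ this, one_div]

/-- A superposition of the functions `dip (δ k)`, vanishing at `1`. It decays slowly there: at
the point `1 - δ k` it is still at least of size `2⁻¹ ^ k`, up to a constant, where `δ k` may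
tend to `0` as fast as we please. -/
noncomputable def dipSum (δ : ℕ → ℝ) (w : ℂ) : ℂ := ∑' k, (1 / 2) ^ k * dip (δ k) w

section dipSum

variable {δ : ℕ → ℝ}

lemma norm_dipSum_term_le (hδ : ∀ k, 0 ≤ δ k) {w : ℂ} (hw : w.re ≤ 1) (k : ℕ) :
    ‖(1 / 2) ^ k * dip (δ k) w‖ ≤ (1 / 2) ^ k := by
  simpa using norm_dip_le_one (hδ k) hw

lemma continuousOn_dipSum (hδ : ∀ k, 0 < δ k) : ContinuousOn (dipSum δ) {w | w.re ≤ 1} :=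
  continuousOn_tsum
    (fun k _ hw ↦ ((differentiableAt_dip (hδ k) hw).continuousAt.const_mul _).continuousWithinAt)
    summable_geometric_two fun k _ hw ↦ norm_dipSum_term_le (fun k ↦ (hδ k).le) hw k

lemma differentiableOn_dipSum (hδ : ∀ k, 0 < δ k) :
    DifferentiableOn ℂ (dipSum δ) {w | w.re < 1} :=
  Complex.differentiableOn_tsum_of_summable_norm summable_geometric_two
    (fun k _ hw ↦
      ((differentiableAt_dip (hδ k) (le_of_lt hw)).const_mul _).differentiableWithinAt)
    (isOpen_lt Complex.continuous_re continuous_const)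
    fun k _ hw ↦ norm_dipSum_term_le (fun k ↦ (hδ k).le) (le_of_lt hw) k

lemma re_dip_le_norm_dipSum (hδ : ∀ k, 0 ≤ δ k) {w : ℂ} (hw : w.re ≤ 1) (k : ℕ) :
    (1 / 2) ^ k * (dip (δ k) w).re ≤ ‖dipSum δ w‖ := by
  have hsum : HasSum (fun k ↦ (1 / 2) ^ k * (dip (δ k) w).re) (dipSum δ w).re := by
    have hsum : Summable fun k ↦ ((1 / 2) ^ k * dip (δ k) w : ℂ) :=
      .of_norm_bounded summable_geometric_two (norm_dipSum_term_le hδ hw)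
    refine (Complex.hasSum_re hsum.hasSum).congr_fun fun k ↦ ?_
    rw [← Complex.re_ofReal_mul]
    push_cast
    rfl
  refine (le_hasSum hsum k fun j _ ↦ ?_).trans (Complex.re_le_norm _)
  exact mul_nonneg (by positivity) (re_dip_nonneg (hδ j) hw)

lemma not_isBigO_dipSum (hδ : ∀ k, 0 < δ k) {r : ℕ → closedBall (0 : ℂ) 1}
    (hr : Tendsto r atTop (𝓝 1)) (hrδ : ∀ k, (r k : ℂ) = 1 - δ k)
    {ω : closedBall (0 : ℂ) 1 → ℝ} (hω : ∀ k, ‖ω (r k)‖ ≤ (1 / 4) ^ k) :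
    ¬ (fun w : closedBall (0 : ℂ) 1 ↦ dipSum δ w) =O[𝓝 1] ω := by
  intro hO
  obtain ⟨C, hC⟩ := (hO.comp_tendsto hr).bound
  have hle : ∀ᶠ k : ℕ in atTop, 1 / 2 ≤ |C| * (1 / 2) ^ k := by
    filter_upwards [hC] with k hk
    have hlower : (1 / 2) ^ k * (1 / 2) ≤ ‖dipSum δ (r k)‖ := by
      have := re_dip_le_norm_dipSum (fun k ↦ (hδ k).le) (re_le_one (r k)) k
      rw [hrδ, dip_one_sub_self (hδ k).ne'] at this
      simpa [hrδ] using this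
    have hupper : ‖dipSum δ (r k)‖ ≤ |C| * (1 / 4) ^ k :=
      hk.trans (mul_le_mul (le_abs_self C) (hω k) (norm_nonneg _) (abs_nonneg C))
    have hpow : (1 / 4 : ℝ) ^ k = (1 / 2) ^ k * (1 / 2) ^ k := by rw [← mul_pow]; norm_num
    refine le_of_mul_le_mul_left ?_ (by positivity : (0 : ℝ) < (1 / 2) ^ k)
    calc (1 / 2) ^ k * (1 / 2) ≤ |C| * (1 / 4) ^ k := hlower.trans hupper
      _ = (1 / 2) ^ k * (|C| * (1 / 2) ^ k) := by rw [hpow]; ring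
  have hlim : Tendsto (fun k : ℕ ↦ |C| * (1 / 2) ^ k) atTop (𝓝 0) := by
    simpa only [mul_zero] using
      (tendsto_pow_atTop_nhds_zero_of_lt_one one_half_pos.le one_half_lt_one).const_mul |C|
  exact one_half_pos.not_ge (ge_of_tendsto hlim hle)

end dipSum

lemma exists_mem_idealAtOne_not_isBigO {ω : closedBall (0 : ℂ) 1 → ℝ}
    (hω : Tendsto ω (𝓝 1) (𝓝 0)) : ∃ v ∈ idealAtOne, ¬ v.1 =O[𝓝 1] ω := by
  have hlim := tendsto_cayley (by simp) tendsto_cobounded_one_add_natCast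
  obtain ⟨φ, hφ, hωφ⟩ := extraction_forall_of_eventually fun k ↦
    (hω.comp hlim).norm.eventually_le_const (by simp : ‖(0 : ℝ)‖ < (1 / 4) ^ k)
  have hδ (k : ℕ) : 0 < (1 + φ k : ℝ)⁻¹ := by positivity
  refine ⟨restrict (dipSum fun k ↦ (1 + φ k)⁻¹)
    ((continuousOn_dipSum hδ).mono fun w hw ↦ re_le_one ⟨w, hw⟩)
    ((differentiableOn_dipSum hδ).mono fun w hw ↦ ?_), ?_,
    not_isBigO_dipSum hδ (hlim.comp hφ.tendsto_atTop) (fun k ↦ ?_) hωφ⟩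
  · exact (Complex.re_le_norm w).trans_lt (mem_ball_zero_iff.1 hw)
  · simp [mem_idealAtOne, restrict, dipSum, dip]
  · simp [cayley]

theorem not_fg_idealAtOne : ¬ idealAtOne.FG := by
  rintro ⟨T, hT⟩
  have hω : Tendsto (fun w ↦ ∑ t ∈ T, ‖t.1 w‖) (𝓝 1) (𝓝 0) := by
    refine Continuous.tendsto' (by fun_prop) _ _ (Finset.sum_eq_zero fun t ht ↦ ?_)
    exact norm_eq_zero.2 (mem_idealAtOne.1 (hT ▸ Ideal.subset_span ht))
  obtain ⟨v, hv, hvω⟩ := exists_mem_idealAtOne_not_isBigO hω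
  exact hvω (isBigO_sum_norm_of_mem_span (hT ▸ hv) 1)

lemma ext_of_ne_one {a b : discAlgebra} (h : ∀ w, w ≠ 1 → a.1 w = b.1 w) : a = b := by
  refine Subtype.ext (ContinuousMap.ext fun w ↦ ?_)
  rcases eq_or_ne w 1 with rfl | hw
  · have hlim := tendsto_cayley (by simp) tendsto_cobounded_one_add_natCast
    exact tendsto_nhds_unique_of_eventuallyEq ((a.1.continuous.tendsto 1).comp hlim)
      ((b.1.continuous.tendsto 1).comp hlim) (.of_forall fun n ↦ h _ (cayley_ne_one _))
  · exact h w hw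

variable {f g : discAlgebra}

lemma inf_span_singleton_eq_map_idealAtOne (hf : ∀ w, w ≠ 1 → f.1 w ≠ 0)
    (hg : ∀ w, g.1 w = singularInner w * f.1 w) :
    Ideal.span {f} ⊓ Ideal.span {g} =
      Submodule.map (LinearMap.mulLeft discAlgebra g) idealAtOne := by
  refine le_antisymm ?_ (Submodule.map_le_iff_le_comap.2 fun v hv ↦ ?_)
  · rintro t ⟨htf, htg⟩
    obtain ⟨u, rfl⟩ := Ideal.mem_span_singleton.1 htf
    obtain ⟨v, huv⟩ := Ideal.mem_span_singleton.1 htg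
    refine ⟨v, apply_one_eq_zero_of_eq_singularInner_mul (u := u.1) fun w hw ↦
      mul_left_cancel₀ (hf w hw) ?_, huv.symm⟩
    calc f.1 w * u.1 w = g.1 w * v.1 w := congrArg (fun a : discAlgebra ↦ a.1 w) huv
      _ = f.1 w * (singularInner w * v.1 w) := by rw [hg]; ring
  · obtain ⟨u, hu⟩ := exists_eq_singularInner_mul hv
    have huv : f * u = g * v := Subtype.ext <| ContinuousMap.ext fun w ↦
      show f.1 w * u.1 w = g.1 w * v.1 w by rw [hu, hg]; ring
    exact ⟨Ideal.mem_span_singleton.2 ⟨u, huv.symm⟩, Ideal.mem_span_singleton.2 ⟨v, rfl⟩⟩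

lemma mulLeft_injective (hg : ∀ w, w ≠ 1 → g.1 w ≠ 0) :
    Function.Injective (LinearMap.mulLeft discAlgebra g) := fun _ _ hab ↦
  ext_of_ne_one fun w hw ↦ mul_left_cancel₀ (hg w hw) (congrArg (fun c : discAlgebra ↦ c.1 w) hab)

theorem not_isCoherentRing : ¬ IsCoherentRing discAlgebra := by
  intro hcoh
  let f : discAlgebra := restrict (fun w ↦ 1 - w) (by fun_prop) (by fun_prop)
  have hf1 : f ∈ idealAtOne := sub_self (1 : ℂ)
  have hf (w : closedBall (0 : ℂ) 1) (hw : w ≠ 1) : f.1 w ≠ 0 :=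
    sub_ne_zero.2 fun h ↦ hw (Subtype.ext h.symm)
  obtain ⟨g, hg⟩ := exists_eq_singularInner_mul hf1
  have hg0 (w : closedBall (0 : ℂ) 1) (hw : w ≠ 1) : g.1 w ≠ 0 :=
    hg w ▸ mul_ne_zero (Complex.exp_ne_zero _) (hf w hw)
  refine not_fg_idealAtOne (Submodule.fg_of_fg_map_injective _ (mulLeft_injective hg0) ?_)
  rw [← inf_span_singleton_eq_map_idealAtOne hf hg]
  exact hcoh.inf_fg _ _ (Submodule.fg_span_singleton f) (Submodule.fg_span_singleton g)

end discAlgebra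

namespace closedPolydisc

variable {d : ℕ}

/-- The diagonal embedding of the closed disc into the closed polydisc. -/
def diagonal (d : ℕ) : C(closedBall (0 : ℂ) 1, closedPolydisc d) where
  toFun w := ⟨fun _ ↦ w, fun _ ↦ mem_closedBall_zero_iff.1 w.2⟩
  continuous_toFun := by fun_prop

lemma norm_expect_lt_one [NeZero d] {z : Fin d → ℂ} (hz : z ∈ polydisc d) : ‖𝔼 i, z i‖ < 1 :=
  (RCLike.norm_expect_le (K := ℂ)).trans_lt
    (Finset.expect_lt (fun i _ ↦ (hz i).le) ⟨0, Finset.mem_univ _, hz 0⟩)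

lemma differentiable_expect : Differentiable ℂ fun z : Fin d → ℂ ↦ 𝔼 i, z i := by
  simp only [Fintype.expect_eq_sum_div_card]
  fun_prop

/-- The arithmetic mean of the coordinates, a symmetric left inverse of the diagonal embedding. -/
noncomputable def mean (d : ℕ) [NeZero d] : C(closedPolydisc d, closedBall (0 : ℂ) 1) where
  toFun z := ⟨𝔼 i, z.1 i, mem_closedBall_zero_iff.2 <|
    (RCLike.norm_expect_le (K := ℂ)).trans (Finset.expect_le Finset.univ_nonempty fun i _ ↦ z.2 i)⟩
  continuous_toFun := (differentiable_expect.continuous.comp continuous_subtype_val).subtype_mk _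

lemma mean_diagonal [NeZero d] (w : closedBall (0 : ℂ) 1) : mean d (diagonal d w) = w :=
  Subtype.ext (Fintype.expect_const (w : ℂ))

lemma mean_permPoint [NeZero d] (σ : Equiv.Perm (Fin d)) (z : closedPolydisc d) :
    mean d (permPoint σ z) = mean d z :=
  Subtype.ext (Fintype.expect_equiv σ _ z.1 fun _ ↦ rfl)

end closedPolydisc

open closedPolydisc

namespace symPolydiscAlgebra

variable (d : ℕ)

/-- Restriction of symmetric functions on the polydisc to the diagonal, the retraction onto the
disc algebra. -/
noncomputable def restrictDiagonal : symPolydiscAlgebra d →ₐ[ℂ] discAlgebra :=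
  ((ContinuousMap.compRightAlgHom ℂ ℂ (diagonal d)).comp (symPolydiscAlgebra d).val).codRestrict
    discAlgebra fun f ↦ by
      obtain ⟨F, hF, hFf⟩ := f.2.1
      refine ⟨fun w ↦ F fun _ ↦ w, hF.comp (by fun_prop) fun w hw _ ↦ ?_, fun w hw ↦
        hFf (diagonal d w) fun _ ↦ mem_ball_zero_iff.1 hw⟩
      exact mem_ball_zero_iff.1 hw

/-- Composition with the coordinate mean, which embeds the disc algebra into the symmetric functions
on the polydisc. -/
noncomputable def compMean [NeZero d] : discAlgebra →ₐ[ℂ] symPolydiscAlgebra d :=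
  ((ContinuousMap.compRightAlgHom ℂ ℂ (mean d)).comp discAlgebra.val).codRestrict
    (symPolydiscAlgebra d) fun f ↦ by
      obtain ⟨F, hF, hFf⟩ := f.2
      refine ⟨⟨fun z ↦ F (𝔼 i, z i), hF.comp differentiable_expect.differentiableOn fun z hz ↦
        mem_ball_zero_iff.2 (norm_expect_lt_one hz), fun z hz ↦
        hFf (mean d z) (mem_ball_zero_iff.2 (norm_expect_lt_one hz))⟩, fun z _ σ ↦ ?_⟩
      exact congrArg f.1 (mean_permPoint σ z)

lemma leftInverse_restrictDiagonal_compMean [NeZero d] :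
    Function.LeftInverse (restrictDiagonal d) (compMean d) := fun f ↦
  Subtype.ext <| ContinuousMap.ext fun w ↦ congrArg f.1 (mean_diagonal w)

end symPolydiscAlgebra

theorem corollary6p4 (d : ℕ) (hd : 1 ≤ d) :
    ¬ IsCoherentRing (symPolydiscAlgebra d) := by
  have : NeZero d := ⟨by omega⟩
  intro hcoh
  exact discAlgebra.not_isCoherentRing <| hcoh.of_leftInverse
    (ρ := (symPolydiscAlgebra.restrictDiagonal d : _ →+* _))
    (ι := (symPolydiscAlgebra.compMean d : _ →+* _))
    (symPolydiscAlgebra.leftInverse_restrictDiagonal_compMean d)
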